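/- For $d\in\mathbb N$ let $\mathcal A_d=\{0,\dots,d-1\}$, and let $f:\mathcal A_d^{\mathbb Z}\to\mathcal A_d^{\mathbb Z}$, $f(x)_k=x_{k+1}$, be the shift map. A shift space over $\mathcal A_d$ is a closed set $X\subset\mathcal A_d^{\mathbb Z}$ (product topology) with $f(X)=X$. Let $\mathcal L(X,n)$ be the set of words of length $n$ that occur in points of $X$, and for nonempty $X$ let $$h_{\rm top}(X)=\inf_{n\ge 1}\frac1n\log|\mathcal L(X,n)|=\lim_{n\to\infty}\frac1n\log|\mathcal L(X,n)|$$ be the topological entropy of $X$. An oracle for $X$ is a function $\psi$ such that for every $k\in\mathbb N$, $\psi(k)$ is a finite list (in any order) of all words in $\mathcal L(X,2k+1)$. An oracle Turing machine $\chi$ computes the entropy map at a nonempty shift space $X_0$ over $\mathcal A_d$ if for every oracle $\psi$ of $X_0$ and every $n\in\mathbb N$ the machine halts on $(\psi,n)$ with a rational output $q=\chi(\psi,n)$ such that, with $\ell$ the largest precision to which $\psi$ is queried in this computation, $|q-h_{\rm top}(X)|<2^{-n}$ for every nonempty shift space $X$ over $\mathcal A_d$ that has an oracle agreeing with $\psi$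 up to precision $\ell$ (in particular for $X=X_0$; if $\psi$ is not queried, for every nonempty $X$). The entropy map $X\mapsto h_{\rm top}(X)$ is computable at $X_0$ if some oracle Turing machine computes it at $X_0$. Then, for every $d$ and every nonempty shift space $X_0$ over $\mathcal A_d$, the entropy map $X\mapsto h_{\rm top}(X)$ is computable at $X_0$ if and only if $h_{\rm top}(X_0)=0$. Moreover, there is a single oracle Turing machine that computes the entropy map at every nonempty shift space $X_0$ (over any $\mathcal A_d$) with $h_{\rm top}(X_0)=0$. -/

import Mathlib

/-- A two-sided shift space over the alphabet `{0, …, d - 1}`: a closed subset `X` of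
`{0, …, d - 1}^ℤ` with `f(X) = X` for the shift `f(x)ₖ = xₖ₊₁`.  It may be empty. -/
structure ShiftSpace (d : ℕ) where
  carrier : Set (ℤ → Fin d)
  isClosed : IsClosed carrier
  image_shift : (fun (x : ℤ → Fin d) (k : ℤ) => x (k + 1)) '' carrier = carrier

/-- The word `x_i x_{i+1} ⋯ x_{i+n-1}` of length `n` in the bi-infinite sequence `x`. -/
def wordAt {d : ℕ} (x : ℤ → Fin d) (i : ℤ) (n : ℕ) : List (Fin d) :=
  List.ofFn fun j : Fin n => x (i + ((j : ℕ) : ℤ))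

namespace ShiftSpace

/-- `𝓛(X, n)`: the words of length `n` that occur in some point of `X`. -/
def language {d : ℕ} (X : ShiftSpace d) (n : ℕ) : Set (List (Fin d)) :=
  {w | ∃ x ∈ X.carrier, ∃ i : ℤ, w = wordAt x i n}

/-- The topological entropy `h_top(X) = inf_{n ≥ 1} (1/n) log |𝓛(X, n)|` of a nonempty shift space
(the infimum is also the limit of the sequence, by subadditivity). -/
noncomputable def entropy {d : ℕ} (X : ShiftSpace d) : ℝ :=
  ⨅ n : {n : ℕ // 1 ≤ n}, Real.log ((X.language n).ncard : ℝ) / ((n : ℕ) : ℝ)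

/-- The set of nonempty shift spaces, the domain of the entropy map. -/
def nonemptyShifts (d : ℕ) : Set (ShiftSpace d) :=
  {X | X.carrier.Nonempty}

/-- `ψ` is an oracle for (the language of) `X`: for every precision `k`, `ψ k` is a finite list,
in an arbitrary order, of all `X`-admissible words of length `2k + 1`. -/
def IsOracle {d : ℕ} (X : ShiftSpace d) (ψ : ℕ → List (List (Fin d))) : Prop :=
  ∀ (k : ℕ) (w : List (Fin d)), w ∈ ψ k ↔ w ∈ X.language (2 * k + 1)

end ShiftSpace

/-- Programs of oracle machines: the programs for partial recursive functions on `ℕ`, with one more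
instruction, `query`, that puts its input to the oracle and returns the answer. -/
inductive OracleMachine : Type where
  | zero : OracleMachine
  | succ : OracleMachine
  | left : OracleMachine
  | right : OracleMachine
  | query : OracleMachine
  | pair : OracleMachine → OracleMachine → OracleMachine
  | comp : OracleMachine → OracleMachine → OracleMachine
  | prec : OracleMachine → OracleMachine → OracleMachine
  | rfind : OracleMachine → OracleMachine

namespace OracleMachine

/-- `Halts O M a v Q`: with the oracle `O`, the machine `M` halts on the input `a`, its output is
`v`, and `Q` is the set of all queries that it puts to the oracle during this computation.

`prec f g` is primitive recursion, and `rfind f` on the input `(a, m)` searches for the least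
`k ≥ m` at which the output of `f` on `(a, k)` is `0`. -/
inductive Halts (O : ℕ → ℕ) : OracleMachine → ℕ → ℕ → Finset ℕ → Prop where
  | zero (a : ℕ) : Halts O zero a 0 ∅
  | succ (a : ℕ) : Halts O succ a (a + 1) ∅
  | left (a : ℕ) : Halts O left a a.unpair.1 ∅
  | right (a : ℕ) : Halts O right a a.unpair.2 ∅
  | query (a : ℕ) : Halts O query a (O a) {a}
  | pair {f g : OracleMachine} {a v w : ℕ} {Q R : Finset ℕ} :
      Halts O f a v Q → Halts O g a w R → Halts O (pair f g) a (Nat.pair v w) (Q ∪ R)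
  | comp {f g : OracleMachine} {a v w : ℕ} {Q R : Finset ℕ} :
      Halts O g a v Q → Halts O f v w R → Halts O (comp f g) a w (Q ∪ R)
  | prec_zero {f g : OracleMachine} {a v : ℕ} {Q : Finset ℕ} :
      Halts O f a v Q → Halts O (prec f g) (Nat.pair a 0) v Q
  | prec_succ {f g : OracleMachine} {a m v w : ℕ} {Q R : Finset ℕ} :
      Halts O (prec f g) (Nat.pair a m) v Q →
      Halts O g (Nat.pair a (Nat.pair m v)) w R →
      Halts O (prec f g) (Nat.pair a (m + 1)) w (Q ∪ R)
  | rfind_stop {f : OracleMachine} {a m : ℕ} {Q : Finset ℕ} :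
      Halts O f (Nat.pair a m) 0 Q → Halts O (rfind f) (Nat.pair a m) m Q
  | rfind_step {f : OracleMachine} {a m v w : ℕ} {Q R : Finset ℕ} :
      Halts O f (Nat.pair a m) (v + 1) Q →
      Halts O (rfind f) (Nat.pair a (m + 1)) w R →
      Halts O (rfind f) (Nat.pair a m) w (Q ∪ R)

end OracleMachine

/-- A list of words as a natural number; the letters are coded by their values, so that the code
does not depend on the size of the alphabet. -/
def wordsCode {d : ℕ} (L : List (List (Fin d))) : ℕ :=
  Encodable.encode (L.map fun w => w.map fun c => (c : ℕ))

/-- The rational number `(a - b) / (c + 1)` coded by the natural number `((a, b), c)`; every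
rational number has a code. -/
def rationalOfCode (v : ℕ) : ℚ :=
  (((v.unpair.1.unpair.1 : ℕ) : ℚ) - ((v.unpair.1.unpair.2 : ℕ) : ℚ)) / (((v.unpair.2 : ℕ) : ℚ) + 1)

/-- `M` computes the function `F`, with domain `S`, at the point `X₀`.  For every oracle `ψ` of `X₀`
and every `n` the machine halts with a rational output `q`.  If `ℓ` is the largest precision to
which it has queried `ψ`, then `|q - F(X)| < 2⁻ⁿ` for every `X` in `S` that has an oracle which
agrees with `ψ` up to precision `ℓ`; among these `X` is `X₀` itself. -/
def OracleMachine.ComputesAt (M : OracleMachine) {d : ℕ} (S : Set (ShiftSpace d))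
    (F : ShiftSpace d → ℝ) (X₀ : ShiftSpace d) : Prop :=
  ∀ ψ : ℕ → List (List (Fin d)), X₀.IsOracle ψ → ∀ n : ℕ,
    ∃ (v : ℕ) (Q : Finset ℕ), M.Halts (fun k => wordsCode (ψ k)) n v Q ∧
      ∀ X ∈ S, ∀ ψ' : ℕ → List (List (Fin d)), X.IsOracle ψ' →
        (∀ k : ℕ, (∃ l ∈ Q, k ≤ l) → ψ' k = ψ k) →
          |((rationalOfCode v : ℚ) : ℝ) - F X| < ((2 : ℝ) ^ n)⁻¹

/-- `F`, with domain `S`, is computable at the point `X₀`. -/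
def ComputableAt {d : ℕ} (S : Set (ShiftSpace d)) (F : ShiftSpace d → ℝ) (X₀ : ShiftSpace d) :
    Prop :=
  ∃ M : OracleMachine, M.ComputesAt S F X₀

/-! Entropy is an infimum of quantities read off from single word lengths, so a finite part of the
oracle can certify an upper bound on it but never a positive lower bound.

If the entropy is zero, the answer `0` is correct as soon as some odd length `m` satisfies `|𝓛(m)| ^
2 ^ n < 2 ^ m`. An unbounded search finds such an `m` (`exists_pow_lt_of_entropy_eq_zero`), and the
queried list bounds the entropy of every shift space sharing it (`entropy_lt_of_pow_lt`). The
machine does not depend on the shift space or the alphabet.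

Conversely, every nonempty `X` shares its words up to any length `N` with a shift space of zero
entropy (`exists_entropy_eq_zero_language_eq`): assign to each word of length `N` one successor and
one predecessor in `X`, and follow these choices in both directions. The walk is deterministic on a
finite set, so it produces only linearly many words. One output would then approximate both
`h_top(X)` and `0`, which is impossible at high precision if `h_top(X) > 0`. -/

/-! ### Searching with an oracle machine -/

namespace OracleMachine

/-- Every primitive recursive function is computed by a machine that never queries the oracle. -/
theorem exists_halts_of_primrec {f : ℕ → ℕ} (hf : Nat.Primrec f) :
    ∃ M : OracleMachine, ∀ (O : ℕ → ℕ) (a : ℕ), M.Halts O a (f a) ∅ := by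
  induction hf with
  | zero => exact ⟨.zero, fun O a => .zero a⟩
  | succ => exact ⟨.succ, fun O a => .succ a⟩
  | left => exact ⟨.left, fun O a => .left a⟩
  | right => exact ⟨.right, fun O a => .right a⟩
  | pair _ _ hf hg =>
    obtain ⟨F, hF⟩ := hf
    obtain ⟨G, hG⟩ := hg
    exact ⟨.pair F G, fun O a => by simpa using Halts.pair (hF O a) (hG O a)⟩
  | comp _ _ hf hg =>
    obtain ⟨F, hF⟩ := hf
    obtain ⟨G, hG⟩ := hg
    exact ⟨.comp F G, fun O a => by simpa using Halts.comp (hG O a) (hF O _)⟩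
  | @prec f g _ _ hf hg =>
    obtain ⟨F, hF⟩ := hf
    obtain ⟨G, hG⟩ := hg
    refine ⟨.prec F G, fun O a => ?_⟩
    have key : ∀ z n : ℕ, Halts O (.prec F G) (Nat.pair z n)
        (n.rec (f z) fun y IH => g (Nat.pair z (Nat.pair y IH))) ∅ := by
      intro z n
      induction n with
      | zero => exact .prec_zero (hF O z)
      | succ n ih => simpa using Halts.prec_succ ih (hG O _)
    simpa using key a.unpair.1 a.unpair.2

/-- An unbounded search for a zero of `t` succeeds as soon as there is a zero, and the queries
needed to evaluate `t` at the result are among the queries of the search. -/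
theorem exists_halts_rfind {O : ℕ → ℕ} {T : OracleMachine} {a : ℕ} {t : ℕ → ℕ}
    {q : ℕ → Finset ℕ} (hT : ∀ k, T.Halts O (Nat.pair a k) (t k) (q k)) (j m : ℕ)
    (h : t (m + j) = 0) :
    ∃ (k : ℕ) (Q : Finset ℕ), (rfind T).Halts O (Nat.pair a m) k Q ∧ t k = 0 ∧ q k ⊆ Q := by
  induction j generalizing m with
  | zero =>
    have hm : t m = 0 := by simpa using h
    exact ⟨m, q m, Halts.rfind_stop (hm ▸ hT m), hm, subset_rfl⟩
  | succ j ih =>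
    rcases hm : t m with _ | v
    · exact ⟨m, q m, Halts.rfind_stop (hm ▸ hT m), hm, subset_rfl⟩
    · obtain ⟨k, Q, h1, h2, h3⟩ := ih (m + 1) (by rw [← h]; congr 1; omega)
      exact ⟨k, q m ∪ Q, .rfind_step (hm ▸ hT m) h1, h2, h3.trans Finset.subset_union_right⟩

/-- For a primitive recursive test `P`, some machine searches for a `k` such that
`P n k (O k) = 0`, and then outputs `0`. -/
theorem exists_search {P : ℕ → ℕ × ℕ → ℕ} (hP : Primrec₂ P) :
    ∃ M : OracleMachine, ∀ (O : ℕ → ℕ) (n : ℕ), (∃ k, P n (k, O k) = 0) →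
      ∃ (k : ℕ) (Q : Finset ℕ), M.Halts O n 0 Q ∧ P n (k, O k) = 0 ∧ k ∈ Q := by
  let p : ℕ → ℕ := fun x => P x.unpair.1.unpair.1 (x.unpair.1.unpair.2, x.unpair.2)
  have hp : Primrec p := by
    have hu := Primrec.unpair
    have h1 : Primrec fun x : ℕ => x.unpair.1 := Primrec.fst.comp hu
    have h2 : Primrec fun x : ℕ => x.unpair.2 := Primrec.snd.comp hu
    exact hP.comp (h1.comp h1) ((h2.comp h1).pair h2)
  obtain ⟨I, hI⟩ := exists_halts_of_primrec Nat.Primrec.id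
  obtain ⟨N, hN⟩ := exists_halts_of_primrec (Primrec.nat_iff.1 hp)
  -- The inner machine sends `(n, k)` to `P n (k, O k)`. The search starts at `(n, 0)`, and the
  -- outer `zero` discards the `k` found.
  refine ⟨.comp .zero (.comp (.rfind (.comp N (.pair I (.comp .query .right)))) (.pair I .zero)),
    fun O n ⟨j, hj⟩ => ?_⟩
  have hT : ∀ k, (OracleMachine.comp N (.pair I (.comp .query .right))).Halts O (Nat.pair n k)
      (P n (k, O k)) {k} := by
    intro k
    have h := ((hI O (Nat.pair n k)).pair ((Halts.right _).comp (.query _))).comp (hN O _)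
    simpa [p] using h
  obtain ⟨k, Q, h1, h2, h3⟩ := exists_halts_rfind hT j 0 (by simpa using hj)
  refine ⟨k, Q, ?_, h2, h3 (by simp)⟩
  have h := (((hI O n).pair (.zero n)).comp h1).comp (.zero k)
  simpa using h

end OracleMachine

/-! ### Counting the words in a code -/

theorem primrec_list_dedup {α : Type*} [Primcodable α] [DecidableEq α] :
    Primrec (List.dedup : List α → List α) := by
  -- Membership is written as `idxOf < length`, a comparison of primitive recursive values.
  have h : Primrec fun l : List α =>
      l.foldr (fun a acc => if acc.idxOf a < acc.length then acc else a :: acc) [] := by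
    refine Primrec.list_foldr .id (.const ([] : List α)) (h := fun _ p =>
      if p.2.idxOf p.1 < p.2.length then p.2 else p.1 :: p.2) ?_
    have h1 : Primrec fun x : List α × (α × List α) => x.2.1 := Primrec.fst.comp .snd
    have h2 : Primrec fun x : List α × (α × List α) => x.2.2 := Primrec.snd.comp .snd
    exact Primrec.ite (Primrec.nat_lt.comp (Primrec.list_idxOf.comp h1 h2)
      (Primrec.list_length.comp h2)) h2 (Primrec.list_cons.comp h1 h2)
  refine h.of_eq fun l => ?_
  induction l with
  | nil => rfl
  | cons a l ih =>
    rw [List.foldr_cons, ih]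
    by_cases ha : a ∈ l
    · rw [List.dedup_cons_of_mem ha, if_pos (List.idxOf_lt_length_iff.2 (List.mem_dedup.2 ha))]
    · rw [List.dedup_cons_of_notMem ha,
        if_neg fun h => ha (List.mem_dedup.1 (List.idxOf_lt_length_iff.1 h))]

/-- The number of distinct words in the list with code `e`. -/
def wordCount (e : ℕ) : ℕ :=
  (Denumerable.ofNat (List (List ℕ)) e).dedup.length

theorem primrec_wordCount : Primrec wordCount :=
  Primrec.list_length.comp (primrec_list_dedup.comp (Primrec.ofNat _))

/-- An oracle may list a word several times, hence the deduplication; coding letters by their values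
is injective and so preserves the count. -/
theorem wordCount_wordsCode {d : ℕ} (L : List (List (Fin d))) :
    wordCount (wordsCode L) = {w | w ∈ L}.ncard := by
  classical
  have hinj : Function.Injective (List.map fun c : Fin d => (c : ℕ)) :=
    List.map_injective_iff.2 Fin.val_injective
  have h1 : wordCount (wordsCode L) = (L.map (List.map fun c : Fin d => (c : ℕ))).dedup.length := by
    unfold wordCount wordsCode
    rw [Denumerable.ofNat_encode]
    simp [List.map_eq_flatMap]
  rw [h1, List.dedup_map_of_injective hinj, List.length_map, ← List.card_toFinset,
    ← Set.ncard_coe_finset]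
  simp

/-- The test `c ^ 2 ^ n < 2 ^ (2 k + 1)`, where `c` is the number of words coded by the second
component of the argument `(k, e)`. -/
def entropyTest (n : ℕ) (p : ℕ × ℕ) : ℕ :=
  if wordCount p.2 ^ 2 ^ n < 2 ^ (2 * p.1 + 1) then 0 else 1

theorem entropyTest_eq_zero {n : ℕ} {p : ℕ × ℕ} :
    entropyTest n p = 0 ↔ wordCount p.2 ^ 2 ^ n < 2 ^ (2 * p.1 + 1) := by
  unfold entropyTest
  split_ifs with h <;> simp [h]

theorem primrec_entropyTest : Primrec₂ entropyTest := by
  have hpow : Primrec₂ ((· ^ ·) : ℕ → ℕ → ℕ) := Primrec₂.unpaired'.1 Nat.Primrec.pow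
  refine Primrec.ite (Primrec.nat_lt.comp
    (hpow.comp (primrec_wordCount.comp (Primrec.snd.comp .snd))
      (hpow.comp (.const 2) .fst))
    (hpow.comp (.const 2) (Primrec.nat_add.comp (Primrec.nat_mul.comp (.const 2)
      (Primrec.fst.comp .snd)) (.const 1)))) (.const 0) (.const 1)

/-! ### Languages and entropy -/

theorem length_wordAt {d : ℕ} (x : ℤ → Fin d) (i : ℤ) (n : ℕ) : (wordAt x i n).length = n := by
  simp [wordAt]

theorem wordAt_eq_iff {d : ℕ} {x y : ℤ → Fin d} {i j : ℤ} {n : ℕ} :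
    wordAt x i n = wordAt y j n ↔ ∀ m : ℕ, m < n → x (i + m) = y (j + m) := by
  rw [wordAt, wordAt, List.ofFn_inj, funext_iff]
  exact ⟨fun h m hm => h ⟨m, hm⟩, fun h m => h m m.2⟩

theorem wordAt_append {d : ℕ} (x : ℤ → Fin d) (i : ℤ) (a b : ℕ) :
    wordAt x i (a + b) = wordAt x i a ++ wordAt x (i + a) b := by
  simp [wordAt, List.ofFn_add, add_assoc]

theorem wordAt_add_shift {d : ℕ} (x : ℤ → Fin d) (i s : ℤ) (n : ℕ) :
    wordAt (fun k => x (k + s)) i n = wordAt x (i + s) n := by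
  rw [wordAt_eq_iff]
  intro m _
  congr 1
  ring

namespace ShiftSpace

variable {d : ℕ} (X : ShiftSpace d)

theorem finite_language (n : ℕ) : (X.language n).Finite := by
  refine (List.finite_length_eq (Fin d) n).subset ?_
  rintro _ ⟨x, -, i, rfl⟩
  exact length_wordAt x i n

theorem language_nonempty (hX : X.carrier.Nonempty) (n : ℕ) : (X.language n).Nonempty :=
  hX.elim fun x hx => ⟨_, x, hx, 0, rfl⟩

/-- Every word of a point extends to the right inside that point. Hence languages that agree at one
length agree at all smaller ones. -/
theorem language_eq_image_take {m n : ℕ} (h : m ≤ n) :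
    X.language m = List.take m '' X.language n := by
  have key (x : ℤ → Fin d) (i : ℤ) : (wordAt x i n).take m = wordAt x i m := by
    obtain ⟨r, rfl⟩ := Nat.exists_eq_add_of_le h
    rw [wordAt_append, List.take_left' (length_wordAt x i m)]
  ext w
  constructor
  · rintro ⟨x, hx, i, rfl⟩
    exact ⟨_, ⟨x, hx, i, rfl⟩, key x i⟩
  · rintro ⟨_, ⟨x, hx, i, rfl⟩, rfl⟩
    exact ⟨x, hx, i, key x i⟩

theorem ncard_language_add_le (a b : ℕ) :
    (X.language (a + b)).ncard ≤ (X.language a).ncard * (X.language b).ncard := by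
  have hsub : X.language (a + b) ⊆ (fun p : List (Fin d) × List (Fin d) => p.1 ++ p.2) ''
      (X.language a ×ˢ X.language b) := by
    rintro _ ⟨x, hx, i, rfl⟩
    exact ⟨(_, _), ⟨⟨x, hx, i, rfl⟩, ⟨x, hx, i + a, rfl⟩⟩, (wordAt_append x i a b).symm⟩
  have hfin := (X.finite_language a).prod (X.finite_language b)
  calc _ ≤ _ := Set.ncard_le_ncard hsub (hfin.image _)
    _ ≤ _ := Set.ncard_image_le hfin
    _ = _ := Set.ncard_prod

theorem ncard_language_zero_le : (X.language 0).ncard ≤ 1 := by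
  refine (Set.ncard_le_one (X.finite_language 0)).2 ?_
  rintro _ ⟨x, -, i, rfl⟩ _ ⟨y, -, j, rfl⟩
  simp [wordAt]

theorem ncard_language_mul_le (m j : ℕ) :
    (X.language (m * j)).ncard ≤ (X.language m).ncard ^ j := by
  induction j with
  | zero => simpa using X.ncard_language_zero_le
  | succ j ih =>
    rw [Nat.mul_succ, pow_succ]
    exact (X.ncard_language_add_le _ _).trans (Nat.mul_le_mul_right _ ih)

theorem log_ncard_div_nonneg (n : ℕ) :
    0 ≤ Real.log ((X.language n).ncard : ℝ) / (n : ℝ) :=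
  div_nonneg (Real.log_natCast_nonneg _) n.cast_nonneg

theorem entropy_nonneg : 0 ≤ X.entropy :=
  Real.iInf_nonneg fun n => X.log_ncard_div_nonneg n

theorem entropy_le {n : ℕ} (hn : 1 ≤ n) :
    X.entropy ≤ Real.log ((X.language n).ncard : ℝ) / (n : ℝ) :=
  ciInf_le (f := fun n : {n : ℕ // 1 ≤ n} => Real.log ((X.language n).ncard : ℝ) / ((n : ℕ) : ℝ))
    ⟨0, by rintro _ ⟨n, rfl⟩; exact X.log_ncard_div_nonneg n⟩ ⟨n, hn⟩

/-- The bound on the entropy that is certified by a successful test. -/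
theorem entropy_lt_of_pow_lt {m n : ℕ} (hm : 1 ≤ m)
    (h : (X.language m).ncard ^ 2 ^ n < 2 ^ m) : X.entropy < ((2 : ℝ) ^ n)⁻¹ := by
  refine (X.entropy_le hm).trans_lt ?_
  have hm' : (0 : ℝ) < m := by exact_mod_cast hm
  rw [div_lt_iff₀ hm', ← div_eq_inv_mul, lt_div_iff₀ (by positivity)]
  rcases (Nat.zero_le (X.language m).ncard).eq_or_lt with h0 | h0
  -- An empty language contributes `Real.log 0 = 0`.
  · simpa [← h0] using hm'
  · have h1 : (((X.language m).ncard : ℝ)) ^ 2 ^ n < 2 ^ m := by exact_mod_cast h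
    have h2 := Real.log_lt_log (by positivity) h1
    rw [Real.log_pow, Real.log_pow] at h2
    push_cast at h2
    -- The test is in base two; since `log 2 < 1`, it is stricter than needed for the natural
    -- logarithm.
    have h3 : (m : ℝ) * Real.log 2 < m * 1 :=
      mul_lt_mul_of_pos_left (Real.log_two_lt_d9.trans (by norm_num)) hm'
    linarith

/-- If the entropy vanishes, then the test succeeds at some odd word length. -/
theorem exists_pow_lt_of_entropy_eq_zero (h : X.entropy = 0) (n : ℕ) :
    ∃ k : ℕ, (X.language (2 * k + 1)).ncard ^ 2 ^ n < 2 ^ (2 * k + 1) := by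
  -- Asking for twice the precision leaves a spare factor `2 ^ (m * j)` to pay for making the length
  -- odd.
  have hpos : 0 < Real.log 2 / 2 ^ (n + 1) := div_pos (Real.log_pos one_lt_two) (by positivity)
  have : Nonempty {n : ℕ // 1 ≤ n} := ⟨⟨1, le_rfl⟩⟩
  obtain ⟨⟨m, hm⟩, hlt⟩ := exists_lt_of_ciInf_lt (h.trans_lt hpos : X.entropy < _)
  have hm' : (0 : ℝ) < m := by exact_mod_cast hm
  set c := (X.language m).ncard with hc
  have hcm : c ^ 2 ^ (n + 1) ≤ 2 ^ m := by
    rcases (Nat.zero_le c).eq_or_lt with h0 | h0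
    · rw [← h0]; simp
    · have h1 : Real.log ((c : ℝ) ^ 2 ^ (n + 1)) ≤ Real.log (2 ^ m) := by
        rw [Real.log_pow, Real.log_pow]
        push_cast
        simp only at hlt
        rw [div_lt_div_iff₀ hm' (by positivity)] at hlt
        linarith
      have h2 := (Real.log_le_log_iff (by positivity) (by positivity)).1 h1
      exact_mod_cast h2
  set b := (X.language 1).ncard
  -- At length `2 * m * j + 1` the extra letter costs a factor `b`, which the test raises to `b ^ 2
  -- ^ n = j`, and `j < 2 ^ j ≤ 2 ^ (m * j)`.
  set j := b ^ 2 ^ n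
  refine ⟨m * j, ?_⟩
  have hle : (X.language (2 * (m * j) + 1)).ncard ≤ c ^ (2 * j) * b := by
    refine (X.ncard_language_add_le _ _).trans (Nat.mul_le_mul_right _ ?_)
    rw [show 2 * (m * j) = m * (2 * j) by ring]
    exact X.ncard_language_mul_le _ _
  calc _ ≤ (c ^ (2 * j) * b) ^ 2 ^ n := Nat.pow_le_pow_left hle _
    _ = (c ^ 2 ^ (n + 1)) ^ j * j := by
      rw [mul_pow, ← pow_mul, ← pow_mul]
      congr 2
      ring
    _ ≤ (2 ^ m) ^ j * 2 ^ (m * j) :=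
      Nat.mul_le_mul (Nat.pow_le_pow_left hcm _) (Nat.lt_two_pow_self.le.trans
        (Nat.pow_le_pow_right two_pos (Nat.le_mul_of_pos_left j hm)))
    _ = 2 ^ (2 * (m * j)) := by rw [← pow_mul, ← pow_add]; congr 1; ring
    _ < 2 ^ (2 * (m * j) + 1) := Nat.pow_lt_pow_right one_lt_two (Nat.lt_succ_self _)

theorem IsOracle.setOf_mem {X : ShiftSpace d} {ψ : ℕ → List (List (Fin d))} (hψ : X.IsOracle ψ)
    (k : ℕ) : {w | w ∈ ψ k} = X.language (2 * k + 1) :=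
  Set.ext fun w => hψ k w

end ShiftSpace

/-- One machine computes the entropy at every shift space with entropy zero. -/
theorem exists_computesAt_entropy :
    ∃ M : OracleMachine, ∀ (d : ℕ) (X₀ : ShiftSpace d), X₀.entropy = 0 →
      M.ComputesAt (ShiftSpace.nonemptyShifts d) ShiftSpace.entropy X₀ := by
  obtain ⟨M, hM⟩ := OracleMachine.exists_search primrec_entropyTest
  refine ⟨M, fun d X₀ h0 ψ hψ n => ?_⟩
  have htest (k : ℕ) : entropyTest n (k, wordsCode (ψ k)) = 0 ↔
      (X₀.language (2 * k + 1)).ncard ^ 2 ^ n < 2 ^ (2 * k + 1) := by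
    rw [entropyTest_eq_zero, wordCount_wordsCode, hψ.setOf_mem]
  obtain ⟨j, hj⟩ := X₀.exists_pow_lt_of_entropy_eq_zero h0 n
  obtain ⟨k, Q, hhalt, hk, hkQ⟩ := hM (fun k => wordsCode (ψ k)) n ⟨j, (htest j).2 hj⟩
  refine ⟨0, Q, hhalt, fun X _ ψ' hψ' hagree => ?_⟩
  have hlang : X.language (2 * k + 1) = X₀.language (2 * k + 1) := by
    rw [← hψ'.setOf_mem, ← hψ.setOf_mem, hagree k ⟨k, hkQ, le_rfl⟩]
  have hlt : X.entropy < ((2 : ℝ) ^ n)⁻¹ :=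
    X.entropy_lt_of_pow_lt (by omega) (hlang ▸ (htest k).1 hk)
  have hcode : rationalOfCode 0 = 0 := by simp [rationalOfCode]
  rw [hcode, Rat.cast_zero, zero_sub, abs_neg, abs_of_nonneg X.entropy_nonneg]
  exact hlt

open Filter Topology

/-! ### Shift spaces generated by a set of sequences -/

theorem isOpen_setOf_wordAt {d : ℕ} (i : ℤ) (n : ℕ) (W : Set (List (Fin d))) :
    IsOpen {x : ℤ → Fin d | wordAt x i n ∈ W} := by
  have hc : Continuous fun (x : ℤ → Fin d) (j : Fin n) => x (i + ((j : ℕ) : ℤ)) := by fun_prop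
  exact (isOpen_discrete {u : Fin n → Fin d | List.ofFn u ∈ W}).preimage hc

namespace ShiftSpace

variable {d : ℕ}

/-- The smallest shift space that contains `Z`: all sequences whose words occur in elements
of `Z`. -/
def generate (Z : Set (ℤ → Fin d)) : ShiftSpace d where
  carrier := {x | ∀ (i : ℤ) (n : ℕ), wordAt x i n ∈ {w | ∃ z ∈ Z, ∃ j : ℤ, w = wordAt z j n}}
  isClosed := by
    simp only [Set.ofPred_forall]
    refine isClosed_iInter fun i => isClosed_iInter fun n => ?_
    rw [← isOpen_compl_iff]
    exact isOpen_setOf_wordAt i n {w | ∃ z ∈ Z, ∃ j : ℤ, w = wordAt z j n}ᶜ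
  image_shift := by
    ext x
    constructor
    · rintro ⟨y, hy, rfl⟩ i n
      rw [wordAt_add_shift]
      exact hy _ _
    · intro hx
      refine ⟨fun k => x (k + -1), fun i n => ?_, ?_⟩
      · rw [wordAt_add_shift]
        exact hx _ _
      · funext k
        simp

theorem subset_generate (Z : Set (ℤ → Fin d)) : Z ⊆ (generate Z).carrier :=
  fun z hz i _ => ⟨z, hz, i, rfl⟩

theorem language_generate (Z : Set (ℤ → Fin d)) (n : ℕ) :
    (generate Z).language n = {w | ∃ z ∈ Z, ∃ j : ℤ, w = wordAt z j n} := by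
  ext w
  constructor
  · rintro ⟨x, hx, i, rfl⟩
    exact hx i n
  · rintro ⟨z, hz, j, rfl⟩
    exact ⟨z, subset_generate Z hz, j, rfl⟩

/-- A shift space whose complexity function grows at most linearly has zero entropy. -/
theorem entropy_eq_zero_of_ncard_le (X : ShiftSpace d) (C : ℕ)
    (h : ∀ n, (X.language n).ncard ≤ C * (n + 2)) : X.entropy = 0 := by
  refine le_antisymm ?_ X.entropy_nonneg
  -- For `n ≥ 1`, `C * (n + 2) ≤ (C + 1) * 3 * n`; using `C + 1` keeps the logarithm nonnegative
  -- even if `C = 0`.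
  have hlim : Tendsto (fun n : ℕ => Real.log ((C + 1 : ℝ) * 3) / (n : ℝ) +
      Real.log (n : ℝ) / (n : ℝ)) atTop (𝓝 (0 + 0)) := by
    refine (tendsto_const_div_atTop_nhds_zero_nat _).add ?_
    exact (Real.isLittleO_log_id_atTop.tendsto_div_nhds_zero).comp tendsto_natCast_atTop_atTop
  rw [add_zero] at hlim
  refine ge_of_tendsto hlim (eventually_atTop.2 ⟨1, fun n hn => ?_⟩)
  refine (X.entropy_le hn).trans ?_
  have hn1 : (1 : ℝ) ≤ n := by exact_mod_cast hn
  rw [← add_div, ← Real.log_mul (by positivity) (by positivity)]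
  refine div_le_div_of_nonneg_right ?_ (by positivity)
  rcases (Nat.zero_le (X.language n).ncard).eq_or_lt with h0 | h0
  · rw [← h0, Nat.cast_zero, Real.log_zero]
    refine Real.log_nonneg ?_
    have : (0 : ℝ) ≤ C := C.cast_nonneg
    nlinarith
  · refine Real.log_le_log (by exact_mod_cast h0) ?_
    have h1 : ((X.language n).ncard : ℝ) ≤ C * (n + 2) := by exact_mod_cast h n
    have : (0 : ℝ) ≤ C := C.cast_nonneg
    nlinarith

end ShiftSpace

/-! ### Approximation by shift spaces of zero entropy -/

/-- The orbit `…, p (p w), p w, w, s w, s (s w), …` indexed by `ℤ`. -/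
def twoSidedOrbit {S : Type*} (s p : S → S) (w : S) (k : ℤ) : S :=
  if 0 ≤ k then s^[k.toNat] w else p^[(-k).toNat] w

section TwoSidedOrbit

variable {S : Type*} (s p : S → S) (w : S)

theorem twoSidedOrbit_natCast (a : ℕ) : twoSidedOrbit s p w a = s^[a] w := by
  simp [twoSidedOrbit]

theorem twoSidedOrbit_neg_natCast (a : ℕ) : twoSidedOrbit s p w (-(a : ℤ)) = p^[a] w := by
  rcases a with _ | a
  · simp [twoSidedOrbit]
  · rw [twoSidedOrbit, if_neg (by omega)]
    simp

/-- Sequences read off along two-sided orbits in a finite set have linear complexity. -/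
theorem ncard_words_twoSidedOrbit_le [Finite S] {d : ℕ} (r : S → Fin d) (n : ℕ) :
    {u | ∃ z ∈ Set.range fun w k => r (twoSidedOrbit s p w k), ∃ i : ℤ, u = wordAt z i n}.ncard ≤
      Nat.card S * (n + 2) := by
  -- A window starting at an index `≥ 0` is determined by its first state, one lying in the negative
  -- indices by the state just after it, and one starting at `-a` with `0 < a < n` by the base point
  -- and `a`.
  let Φ : S ⊕ S ⊕ S × Fin n → List (Fin d) := Sum.elim
    (fun u => List.ofFn fun j : Fin n => r (s^[j] u)) (Sum.elim
    (fun u => List.ofFn fun j : Fin n => r (p^[n - j] u))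
    (fun q => wordAt (fun k => r (twoSidedOrbit s p q.1 k)) (-((q.2 : ℕ) : ℤ)) n))
  have hsub : {u | ∃ z ∈ Set.range fun w k => r (twoSidedOrbit s p w k),
      ∃ i : ℤ, u = wordAt z i n} ⊆ Set.range Φ := by
    rintro _ ⟨_, ⟨w, rfl⟩, i, rfl⟩
    rcases le_or_gt 0 i with hi | hi
    · obtain ⟨a, rfl⟩ := Int.eq_ofNat_of_zero_le hi
      refine ⟨.inl (s^[a] w), ?_⟩
      simp only [Φ, Sum.elim_inl, wordAt]
      congr 1
      funext j
      rw [← Nat.cast_add, twoSidedOrbit_natCast, add_comm, Function.iterate_add_apply]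
    · obtain ⟨a, rfl⟩ := Int.exists_eq_neg_ofNat hi.le
      rcases lt_or_ge a n with han | han
      · exact ⟨.inr (.inr (w, ⟨a, han⟩)), rfl⟩
      · obtain ⟨b, rfl⟩ := Nat.exists_eq_add_of_le han
        refine ⟨.inr (.inl (p^[b] w)), ?_⟩
        simp only [Φ, Sum.elim_inl, Sum.elim_inr, wordAt]
        congr 1
        funext j
        have hj : -((n + b : ℕ) : ℤ) + ((j : ℕ) : ℤ) = -((n - j + b : ℕ) : ℤ) := by omega
        rw [hj, twoSidedOrbit_neg_natCast, Function.iterate_add_apply]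
  calc _ ≤ (Set.range Φ).ncard := Set.ncard_le_ncard hsub (Set.finite_range Φ)
    _ ≤ Nat.card (S ⊕ S ⊕ S × Fin n) := by
      rw [← Set.image_univ, ← Set.ncard_univ]
      exact Set.ncard_image_le Set.finite_univ
    _ = Nat.card S * (n + 2) := by
      rw [Nat.card_sum, Nat.card_sum, Nat.card_prod, Nat.card_fin]
      ring

/-- If `rep (s u)` and `rep (p u)` are, on a window of length `N`, shifts of `rep u`, then every
window of length `N` in the sequence read off along a two-sided orbit agrees with the corresponding
window of `rep`. -/
theorem wordAt_twoSidedOrbit {d N : ℕ} (rep : S → ℤ → Fin d)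
    (hs : ∀ u, wordAt (rep (s u)) 0 N = wordAt (rep u) 1 N)
    (hp : ∀ u, wordAt (rep (p u)) 0 N = wordAt (rep u) (-1) N) (k : ℤ) :
    wordAt (fun k => rep (twoSidedOrbit s p w k) 0) k N =
      wordAt (rep (twoSidedOrbit s p w k)) 0 N := by
  have step (k : ℤ) (m : ℕ) (hm : m + 1 < N) :
      rep (twoSidedOrbit s p w (k + 1)) m = rep (twoSidedOrbit s p w k) (m + 1) := by
    rcases le_or_gt 0 k with hk | hk
    · obtain ⟨a, rfl⟩ := Int.eq_ofNat_of_zero_le hk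
      have h := wordAt_eq_iff.1 (hs (s^[a] w)) m (by omega)
      rw [zero_add, add_comm (1 : ℤ)] at h
      rw [← Nat.cast_succ, twoSidedOrbit_natCast, twoSidedOrbit_natCast,
        Function.iterate_succ_apply', h]
    · obtain ⟨a, rfl⟩ : ∃ a : ℕ, k = -((a + 1 : ℕ) : ℤ) := ⟨(-k - 1).toNat, by omega⟩
      have h := wordAt_eq_iff.1 (hp (p^[a] w)) (m + 1) hm
      rw [zero_add, Nat.cast_succ, neg_add_cancel_comm_assoc] at h
      rw [show -((a + 1 : ℕ) : ℤ) + 1 = -(a : ℤ) by push_cast; ring, twoSidedOrbit_neg_natCast,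
        twoSidedOrbit_neg_natCast, Function.iterate_succ_apply', h]
  rw [wordAt_eq_iff]
  intro m hm
  rw [zero_add]
  -- Position `m + 1` of the window at `k` is position `m` of the window at `k + 1`, so the letter
  -- moves down to position `0`.
  induction m generalizing k with
  | zero => simp
  | succ m ih =>
    rw [Nat.cast_succ, ← step k m hm, ← ih (k + 1) (by omega)]
    congr 2
    ring

end TwoSidedOrbit

namespace ShiftSpace

variable {d : ℕ} (X : ShiftSpace d)

/-- Backward shifts rely on `f(X) = X` rather than mere invariance: a point of `X` has a preimage in
`X`, and the shift is injective. -/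
theorem shift_mem {x : ℤ → Fin d} (hx : x ∈ X.carrier) (i : ℤ) :
    (fun k => x (k + i)) ∈ X.carrier := by
  induction i with
  | zero => simpa using hx
  | succ i ih =>
    rw [← X.image_shift]
    refine ⟨_, ih, ?_⟩
    funext k
    simp only
    congr 1
    ring
  | pred i ih =>
    rw [← X.image_shift] at ih
    obtain ⟨y, hy, he⟩ := ih
    convert hy using 1
    funext k
    have := congrFun he (k - 1)
    simp only [sub_add_cancel] at this
    rw [this]
    congr 1
    ring

theorem exists_mem_wordAt_zero {n : ℕ} {w : List (Fin d)} (hw : w ∈ X.language n) :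
    ∃ x ∈ X.carrier, wordAt x 0 n = w := by
  obtain ⟨x, hx, i, rfl⟩ := hw
  exact ⟨_, X.shift_mem hx i, by rw [wordAt_add_shift, zero_add]⟩

/-- Shift spaces of zero entropy approximate every nonempty shift space. -/
theorem exists_entropy_eq_zero_language_eq (hX : X.carrier.Nonempty) (N : ℕ) :
    ∃ Y : ShiftSpace d, Y.carrier.Nonempty ∧ Y.entropy = 0 ∧
      ∀ n ≤ N, Y.language n = X.language n := by
  have : Finite (X.language N) := X.finite_language N
  choose rep hrep hword using fun w : X.language N => X.exists_mem_wordAt_zero w.2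
  -- Sliding the window of a representative in `X` by one place, right for `s` and left for `p`,
  -- stays in the language.
  let s : X.language N → X.language N := fun w => ⟨wordAt (rep w) 1 N, _, hrep w, _, rfl⟩
  let p : X.language N → X.language N := fun w => ⟨wordAt (rep w) (-1) N, _, hrep w, _, rfl⟩
  let Z : Set (ℤ → Fin d) := Set.range fun w k => rep (twoSidedOrbit s p w k) 0
  have hlang : (generate Z).language N = X.language N := by
    have key (w : X.language N) (k : ℤ) :
        wordAt (fun k => rep (twoSidedOrbit s p w k) 0) k N = twoSidedOrbit s p w k := by
      rw [wordAt_twoSidedOrbit s p w rep (fun u => hword (s u)) (fun u => hword (p u)), hword]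
    rw [language_generate]
    ext u
    constructor
    · rintro ⟨_, ⟨w, rfl⟩, k, rfl⟩
      rw [key]
      exact Subtype.coe_prop _
    · intro hu
      exact ⟨_, ⟨⟨u, hu⟩, rfl⟩, 0, (key ⟨u, hu⟩ 0).symm⟩
  refine ⟨generate Z, ?_, ?_, fun n hn => ?_⟩
  · obtain ⟨u, hu⟩ := X.language_nonempty hX N
    exact ⟨_, subset_generate Z ⟨⟨u, hu⟩, rfl⟩⟩
  · refine entropy_eq_zero_of_ncard_le _ (Nat.card (X.language N)) fun n => ?_
    rw [language_generate]
    exact ncard_words_twoSidedOrbit_le s p (fun u => rep u 0) n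
  · rw [language_eq_image_take _ hn, hlang, ← language_eq_image_take _ hn]

theorem exists_isOracle : ∃ ψ : ℕ → List (List (Fin d)), X.IsOracle ψ :=
  ⟨fun k => (X.finite_language (2 * k + 1)).toFinset.toList, fun k w => by simp⟩

/-- The entropy is not computable at a shift space with positive entropy. -/
theorem entropy_eq_zero_of_computableAt (hX : X.carrier.Nonempty)
    (h : ComputableAt (nonemptyShifts d) entropy X) : X.entropy = 0 := by
  obtain ⟨M, hM⟩ := h
  by_contra hne
  have hpos : 0 < X.entropy := X.entropy_nonneg.lt_of_ne' hne
  obtain ⟨n, hn⟩ := exists_pow_lt_of_lt_one (half_pos hpos) (one_half_lt_one (α := ℝ))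
  rw [one_div, inv_pow] at hn
  obtain ⟨ψ, hψ⟩ := X.exists_isOracle
  obtain ⟨v, Q, -, hv⟩ := hM ψ hψ n
  obtain ⟨Y, hY, hY0, hlang⟩ :=
    -- This is the greatest word length that a query in `Q` can reveal.
    X.exists_entropy_eq_zero_language_eq hX (2 * Q.sup id + 1)
  obtain ⟨φ, hφ⟩ := Y.exists_isOracle
  have h1 := hv X hX ψ hψ fun _ _ => rfl
  -- Agreement must be literal, including the order of the lists, so the oracle for `Y` copies `ψ`
  -- up to the largest query.
  have h2 := hv Y hY (fun k => if k ≤ Q.sup id then ψ k else φ k)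
    (fun k w => by
      by_cases hk : k ≤ Q.sup id
      · simp only [if_pos hk]
        rw [hψ, hlang _ (by omega)]
      · simp only [if_neg hk]
        exact hφ k w)
    (fun k ⟨l, hl, hkl⟩ => if_pos (hkl.trans (Finset.le_sup (f := id) hl)))
  rw [hY0, sub_zero] at h2
  have h3 := abs_lt.1 h1
  have h4 := abs_lt.1 h2
  linarith [h3.1, h4.2]

end ShiftSpace

theorem corollary5 :
    (∀ (d : ℕ) (X₀ : ShiftSpace d), X₀.carrier.Nonempty →
      (ComputableAt (ShiftSpace.nonemptyShifts d) ShiftSpace.entropy X₀ ↔ X₀.entropy = 0)) ∧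
    ∃ M : OracleMachine, ∀ (d : ℕ) (X₀ : ShiftSpace d), X₀.carrier.Nonempty → X₀.entropy = 0 →
      M.ComputesAt (ShiftSpace.nonemptyShifts d) ShiftSpace.entropy X₀ := by
  obtain ⟨M, hM⟩ := exists_computesAt_entropy
  exact ⟨fun d X₀ hX => ⟨X₀.entropy_eq_zero_of_computableAt hX, fun h => ⟨M, hM d X₀ h⟩⟩,
    M, fun d X₀ _ h => hM d X₀ h⟩
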